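/- Inner products are linear in the second variable. Let $X$ be a set, $H$ a complex Hilbert space and $K:X\times X\to B(H)$ a positive definite kernel, i.e. $\sum_{i,j}\langle h_i,K(x_i,x_j)h_j\rangle\ge 0$ for all finite families $(x_i,h_i)$ in $X\times H$. Let $\mathcal H_{\tilde K}$ be the reproducing kernel Hilbert space of the scalar kernel $\tilde K((x,a),(y,b))=\langle a,K(x,y)b\rangle_H$ on $X\times H$, with kernel sections $\tilde K_{(x,a)}=\tilde K(\cdot,(x,a))$. Let $S$ be a measurable space and, for each $s\in S$, let $\Phi_s:B(H)\to B(H)$ be a normal completely positive map with Kraus family $(A_{s,r})_{r\in I(s)}$, so that $\Phi_s(T)=\sum_{r\in I(s)}A_{s,r}^*TA_{s,r}$ in the strong operator topology. For a word $w=s_1\cdots s_n$ put $K_w(x,y)=\Phi_{s_1}\circ\cdots\circ\Phi_{s_n}(K(x,y))$. Let $R$ be the set of finite strings of pairs $(s,r)$ with $s\in S$, $r\in I(s)$ (including the empty string), let $M=\ell^2(R)\otimes\mathcal H_{\tilde K}=\bigoplus_{\rho\in R}\mathcal H_{\tilde K}$, and write $e_\rho\cdot F$ for the vector $F$ in the $\rho$-th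 summand. Assume that for each $s\in S$ the formula $$C_s\bigl(e_\rho\cdot\tilde K_{(x,a)}\bigr)=\sum_{r\in I(s)}e_{(s,r)\rho}\cdot\tilde K_{(x,A_{s,r}a)}\qquad(\rho\in R,\ x\in X,\ a\in H)$$ defines a (necessarily unique) bounded operator $C_s:M\to M$. For $w=s_1\cdots s_n$ put $C_w=C_{s_n}\cdots C_{s_1}$. Let $\mu$ be a probability measure on $S$, let $\mathbb P=\mu^{\otimes\mathbb N}$ on $\Omega=S^{\mathbb N}$, let $z_n(\omega)=\omega_n$ be the coordinates and $\xi_n(\omega)=z_1(\omega)\cdots z_n(\omega)$. Assume that $\omega\mapsto\|C_{\xi_n(\omega)}\|$ is $\mathbb P$-measurable for every $n$ and that $\mathbb E[\log^+\|C_{z_1}\|]<\infty$. With the convention $\log 0=-\infty$, there is a deterministic constant $\lambda\in[-\infty,\infty)$ (the Lyapunov exponent) with $$\lim_{n\to\infty}\tfrac1n\log\|C_{\xi_n(\omega)}\|=\lambda\quad\text{for }\mathbb P\text{-a.e. }\omega,\qquad \lambda=\inf_{n\ge1}\tfrac1n\mathbb E[\log\|C_{\xi_n}\|]=\lim_{n\to\infty}\tfrac1n\mathbb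 E[\log\|C_{\xi_n}\|],$$ and for this $\lambda$: 1. for all $x,y\in X$ and $a,b\in H$, $\displaystyle\limsup_{n\to\infty}\tfrac1n\log\bigl|\langle a,K_{\xi_n(\omega)}(x,y)b\rangle_H\bigr|\le2\lambda$ for $\mathbb P$-a.e. $\omega$; 2. for all $x,y\in X$, $\displaystyle\limsup_{n\to\infty}\tfrac1n\log\bigl\|K_{\xi_n(\omega)}(x,y)\bigr\|\le2\lambda$ for $\mathbb P$-a.e. $\omega$. -/

import Mathlib

open MeasureTheory Filter Topology
open scoped ENNReal ComplexOrder InnerProductSpace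

noncomputable section

/-- An operator-valued positive definite kernel `K : X × X → B(H)`: for every finite family
`(x i, h i)` the number `∑ i j, ⟨h i, K (x i) (x j) (h j)⟩` is real and nonnegative. -/
structure PDKernel (X H : Type*) [NormedAddCommGroup H] [InnerProductSpace ℂ H] where
  toFun : X → X → H →L[ℂ] H
  posDef : ∀ (m : ℕ) (x : Fin m → X) (h : Fin m → H),
    0 ≤ ∑ i, ∑ j, ⟪h i, toFun (x i) (x j) (h j)⟫_ℂ

section Model

variable {X H S : Type*} {I : S → Type*} [NormedAddCommGroup H] [InnerProductSpace ℂ H]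

/-- The scalar kernel `K̃((x,a),(y,b)) = ⟨a, K(x,y) b⟩` on `X × H`.
A complex number is identified with the operator of multiplication by it on `ℂ`. -/
def scalarKernel (K : PDKernel X H) : Matrix (X × H) (X × H) (ℂ →L[ℂ] ℂ) :=
  Matrix.of fun p q => ⟪p.2, K.toFun p.1 q.1 q.2⟫_ℂ • ContinuousLinearMap.id ℂ ℂ

theorem PDKernel.conj_symm (K : PDKernel X H) (x y : X) (a b : H) :
    star ⟪a, K.toFun x y b⟫_ℂ = ⟪b, K.toFun y x a⟫_ℂ := by
  have h1 := K.posDef 1 ![x] ![a]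
  have h2 := K.posDef 1 ![y] ![b]
  have h3 := K.posDef 2 ![x, y] ![a, b]
  have h4 := K.posDef 2 ![x, y] ![a, Complex.I • b]
  simp [Fin.sum_univ_two] at h1 h2 h3 h4
  have e1 := (Complex.nonneg_iff.1 h1).2
  have e2 := (Complex.nonneg_iff.1 h2).2
  have e3 := (Complex.nonneg_iff.1 h3).2
  have e4 := (Complex.nonneg_iff.1 h4).2
  simp at e1 e2 e3 e4
  apply Complex.ext
  · rw [Complex.star_def, Complex.conj_re]; linarith
  · rw [Complex.star_def, Complex.conj_im]; linarith

theorem PDKernel.finset_sum_nonneg (K : PDKernel X H) {ι : Type*} (s : Finset ι)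
    (x : ι → X) (h : ι → H) :
    0 ≤ ∑ i ∈ s, ∑ j ∈ s, ⟪h i, K.toFun (x i) (x j) (h j)⟫_ℂ := by
  have key := K.posDef s.card (fun i => x (s.equivFin.symm i)) (fun i => h (s.equivFin.symm i))
  have e : ∀ f : ι → ℂ, ∑ i ∈ s, f i = ∑ i : Fin s.card, f (s.equivFin.symm i) := by
    intro f
    rw [← Finset.sum_coe_sort s, ← Equiv.sum_comp s.equivFin.symm]
  rw [e]
  simp_rw [e]
  exact key

theorem scalarKernel_posSemidef (K : PDKernel X H) : (scalarKernel K).PosSemidef := by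
  refine ((RKHS.posSemidef_tfae (K := scalarKernel K)).out 0 2).2 ?_
  refine ⟨?_, fun v => ?_⟩
  · ext p q
    simp only [Matrix.conjTranspose_apply, scalarKernel, Matrix.of_apply, star_smul]
    rw [K.conj_symm]
    have : star (ContinuousLinearMap.id ℂ ℂ) = ContinuousLinearMap.id ℂ ℂ := star_one _
    rw [this]
  · have key := K.finset_sum_nonneg v.support (fun p => p.1)
      (fun p => v p • p.2)
    have key' := (Complex.nonneg_iff.1 key).1
    simp only [Finsupp.sum]
    rw [Finset.sum_comm]
    refine key'.trans_eq ?_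
    rw [← Complex.conj_re]
    simp only [RCLike.re_to_complex]
    congr 1
    simp only [map_sum]
    refine Finset.sum_congr rfl fun p _ => Finset.sum_congr rfl fun q _ => ?_
    simp [scalarKernel]
    ring

instance (K : PDKernel X H) : Fact (scalarKernel K).PosSemidef := ⟨scalarKernel_posSemidef K⟩

/-- The reproducing kernel Hilbert space of the scalar kernel `K̃`. -/
abbrev KernelSpace (K : PDKernel X H) : Type _ := RKHS.OfKernel (scalarKernel K)

/-- The kernel section `K̃_(x,a) = K̃(·,(x,a))`. -/
def kernelSection (K : PDKernel X H) (x : X) (a : H) : KernelSpace K :=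
  RKHS.kerFun (KernelSpace K) (x, a) 1

theorem kernelSection_apply (K : PDKernel X H) (x y : X) (a b : H) :
    kernelSection K y b (x, a) = ⟪a, K.toFun x y b⟫_ℂ := by
  rw [kernelSection, RKHS.kerFun_apply, RKHS.OfKernel.kernel_ofKernel]
  simp [scalarKernel]

theorem inner_kernelSection (K : PDKernel X H) (x y : X) (a b : H) :
    ⟪kernelSection K x a, kernelSection K y b⟫_ℂ = ⟪a, K.toFun x y b⟫_ℂ := by
  rw [← kernelSection_apply, kernelSection, RKHS.kerFun_inner]
  simp


/-- The index set `R`: strings `(r₁, …, rₙ)` with `r_j ∈ I(s_j)` for some word `s₁ ⋯ sₙ`, each `r_j`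
remembering its letter `s_j`; the empty string is `[]`. -/
abbrev KrausString (I : S → Type*) : Type _ := List (Σ s, I s)

/-- The model space `M = ℓ²(R) ⊗ H_K̃`, as the Hilbert sum of copies of `H_K̃` indexed by `R`. -/
abbrev ModelSpace (K : PDKernel X H) (I : S → Type*) : Type _ :=
  lp (fun _ : KrausString I => KernelSpace K) 2

open Classical in
/-- The elementary vector `e_ρ · F`, i.e. `F` placed in the `ρ`-th summand. -/
def elementary (K : PDKernel X H) (ρ : KrausString I) (F : KernelSpace K) : ModelSpace K I :=
  lp.single 2 ρ F

/-- The defining formula of the creation operator of the letter `s`: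
`C_s (e_ρ · K̃_(x,a)) = ∑_{r ∈ I(s)} e_{rρ} · K̃_(x, A_{s,r} a)`. -/
def IsCreationOperator (K : PDKernel X H) (A : ∀ s, I s → H →L[ℂ] H) (s : S)
    (T : ModelSpace K I →L[ℂ] ModelSpace K I) : Prop :=
  ∀ (ρ : KrausString I) (x : X) (a : H),
    HasSum (fun r : I s => elementary K (⟨s, r⟩ :: ρ) (kernelSection K x (A s r a)))
      (T (elementary K ρ (kernelSection K x a)))

/-- A bounded operator on the model space is determined by its values on the vectors
`e_ρ · K̃_(x,a)`. -/
theorem IsCreationOperator.unique {K : PDKernel X H} {A : ∀ s, I s → H →L[ℂ] H} {s : S}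
    {T T' : ModelSpace K I →L[ℂ] ModelSpace K I}
    (hT : IsCreationOperator K A s T) (hT' : IsCreationOperator K A s T') : T = T' := by
  classical
  refine lp.ext_continuousLinearMap (by simp) fun ρ => ?_
  refine ContinuousLinearMap.ext_on (s := {RKHS.kerFun (KernelSpace K) p c | (p) (c)})
    (Submodule.dense_iff_topologicalClosure_eq_top.2 (RKHS.kerFun_dense (KernelSpace K))) ?_
  rintro _ ⟨⟨x, a⟩, c, rfl⟩
  have h1 : RKHS.kerFun (KernelSpace K) (x, a) c = c • kernelSection K x a := by
    rw [kernelSection, ← map_smul, smul_eq_mul, mul_one]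
  rw [h1, map_smul, map_smul]
  congr 1
  have h2 := (hT ρ x a).unique (hT' ρ x a)
  unfold elementary at h2
  simp only [ContinuousLinearMap.comp_apply, lp.singleContinuousLinearMap_apply]
  convert h2

/-- The formula for `C_s` defines a bounded operator on the model space. -/
def HasCreationOperator (K : PDKernel X H) (A : ∀ s, I s → H →L[ℂ] H) (s : S) : Prop :=
  ∃ T : ModelSpace K I →L[ℂ] ModelSpace K I, IsCreationOperator K A s T

/-- The creation operator `C_s`, the unique bounded operator given by its defining formula. -/
def creationOperator {K : PDKernel X H} {A : ∀ s, I s → H →L[ℂ] H} {s : S}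
    (h : HasCreationOperator K A s) : ModelSpace K I →L[ℂ] ModelSpace K I :=
  h.choose

theorem creationOperator_spec {K : PDKernel X H} {A : ∀ s, I s → H →L[ℂ] H} {s : S}
    (h : HasCreationOperator K A s) : IsCreationOperator K A s (creationOperator h) :=
  h.choose_spec

/-- `C_w = C_{sₙ} ⋯ C_{s₁}` for a word `w = s₁ ⋯ sₙ`, and `C_∅ = I`. -/
def wordOperator {M : Type*} [NormedAddCommGroup M] [NormedSpace ℂ M] (C : S → M →L[ℂ] M) :
    List S → M →L[ℂ] M
  | [] => ContinuousLinearMap.id ℂ M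
  | s :: w => (wordOperator C w).comp (C s)

/-- The iterated kernel `K_w = Φ_{s₁} ∘ ⋯ ∘ Φ_{sₙ} (K)` for `w = s₁ ⋯ sₙ`, and `K_∅ = K`. -/
def iteratedKernel (Φ : S → (H →L[ℂ] H) →ₗ[ℂ] (H →L[ℂ] H)) (K : PDKernel X H) :
    List S → X → X → H →L[ℂ] H
  | [] => K.toFun
  | s :: w => fun x y => Φ s (iteratedKernel Φ K w x y)

/-- `Φ` is the normal completely positive map with Kraus family `A`:
`Φ(T) = ∑_r A_r^* T A_r`, the sum converging in the strong operator topology.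
(Normal completely positive maps on `B(H)` are exactly the maps that admit such a family.) -/
def HasKrausFamily [CompleteSpace H] {J : Type*} (Φ : (H →L[ℂ] H) →ₗ[ℂ] (H →L[ℂ] H))
    (A : J → H →L[ℂ] H) : Prop :=
  ∀ (T : H →L[ℂ] H) (v : H),
    HasSum (fun r => (ContinuousLinearMap.adjoint (A r)) (T (A r v))) (Φ T v)

end Model

/-- The law of an i.i.d. sequence with one-step law `μ`, on the path space `S^ℕ`
(the path is `ω 0, ω 1, …`, so that `z_{k+1}(ω) = ω k`). -/
def pathMeasure {S : Type*} [MeasurableSpace S] (μ : Measure S) [IsProbabilityMeasure μ] :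
    Measure (ℕ → S) :=
  Measure.infinitePi fun _ => μ

/-- The random word `ξ_n(ω) = z₁(ω) ⋯ z_n(ω)`. -/
def randomWord {S : Type*} (ω : ℕ → S) (n : ℕ) : List S := (List.range n).map ω

/-- The logarithm of a nonnegative real number with values in `[-∞, ∞)`; `log 0 = -∞`. -/
def extLog (r : ℝ) : EReal := ENNReal.log (ENNReal.ofReal r)

/-- The expectation `E[f] = E[f⁺] - E[f⁻]` of an extended-real function, with values in `[-∞, ∞)`
whenever `E[f⁺] < ∞`. -/
def extExpectation {Ω : Type*} [MeasurableSpace Ω] (P : Measure Ω) (f : Ω → EReal) : EReal :=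
  ((∫⁻ ω, (f ω).toENNReal ∂P : ℝ≥0∞) : EReal) - ((∫⁻ ω, (-f ω).toENNReal ∂P : ℝ≥0∞) : EReal)

/-- `l ∈ [-∞, ∞)` is the (deterministic) Lyapunov exponent of the process `N_n ≥ 0`:
`(1/n) log N_n → l` almost surely, and `l = inf_{n ≥ 1} (1/n) E[log N_n] = lim (1/n) E[log N_n]`. -/
structure IsLyapunovExponent {Ω : Type*} [MeasurableSpace Ω] (P : Measure Ω) (N : ℕ → Ω → ℝ)
    (l : EReal) : Prop where
  lt_top : l < ⊤
  tendsto_ae : ∀ᵐ ω ∂P, Tendsto (fun n : ℕ => extLog (N n ω) / (n : EReal)) atTop (𝓝 l)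
  eq_iInf : l = ⨅ (n : ℕ) (_ : 1 ≤ n), extExpectation P (fun ω => extLog (N n ω)) / (n : EReal)
  tendsto_expectation :
    Tendsto (fun n : ℕ => extExpectation P (fun ω => extLog (N n ω)) / (n : EReal)) atTop (𝓝 l)

end

/-! ### The subadditive ergodic theorem -/

/-! Two ingredients meet: a Gram identity on the model space and Kingman's theorem for the Bernoulli
shift.

Peeling off the first letter of `w` and using the orthogonality of distinct summands together with
the Kraus sum shows that the vectors `C_w (e_ρ · K̃_(x,a))` have Gram matrix `⟨a, K_w(x,y) b⟩`,
block diagonal in `ρ` (`inner_wordOperator_elementary`). Cauchy–Schwarz then bounds `K_w(x,y)` by a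
constant times `‖C_w‖²`, and the square is the source of the factor in `2λ`.

The norms `‖C_{ξ_n}‖` form a submultiplicative cocycle over the shift, but their logarithms may be
`-∞` or fail to be integrable. Truncating at `-M n` keeps subadditivity and gives integrability, so
`ae_tendsto_div` applies for each `M`; the exponent is recovered as `M → ∞` in
`exists_isLyapunovExponent`. In Kingman's theorem the lower bound is a covering argument along
orbits (`le_sum_badSet`, `ae_eventually_lt`). The upper bound cuts time into blocks of length `m`
and applies Birkhoff to `T^[m]`, which is why all powers of the shift are required to be ergodic. -/

theorem integral_comp_iterate {Ω : Type*} [MeasurableSpace Ω] {P : Measure Ω} {T : Ω → Ω}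
    (hT : MeasurePreserving T P P) {g : Ω → ℝ} (hg : Integrable g P) (i : ℕ) :
    ∫ ω, g (T^[i] ω) ∂P = ∫ ω, g ω ∂P := by
  have hi := hT.iterate i
  conv_rhs => rw [← hi.map_eq]
  rw [integral_map hi.measurable.aemeasurable]
  rw [hi.map_eq]
  exact hg.1

/-- A subadditive cocycle over the map `T`. -/
structure IsSubadditiveCocycle {Ω : Type*} (T : Ω → Ω) (f : ℕ → Ω → ℝ) : Prop where
  zero_le : ∀ ω, f 0 ω ≤ 0
  add_le : ∀ m n ω, f (m + n) ω ≤ f m ω + f n (T^[m] ω)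

namespace IsSubadditiveCocycle

variable {Ω : Type*} {T : Ω → Ω} {f : ℕ → Ω → ℝ}

/-- The points at which none of `f 1, …, f N` is nonpositive. -/
def badSet (f : ℕ → Ω → ℝ) (N : ℕ) : Set Ω := {ω | ∀ n, 1 ≤ n → n ≤ N → 0 < f n ω}

theorem le_birkhoffSum (hf : IsSubadditiveCocycle T f) (n : ℕ) (ω : Ω) :
    f n ω ≤ birkhoffSum T (fun ω => max (f 1 ω) 0) n ω := by
  induction n generalizing ω with
  | zero => simpa using hf.zero_le ω
  | succ n ih =>
    rw [birkhoffSum_succ']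
    have h1 := hf.add_le 1 n ω
    rw [add_comm 1 n] at h1
    have h2 := ih (T ω)
    have h3 := le_max_left (f 1 ω) 0
    simp only [Function.iterate_one] at h1
    linarith

/-- Greedy walk along the orbit. At a good point jump ahead by some `k ≤ N` with `f k ≤ 0`, at no
cost; at a bad point advance one step and pay `(f 1)⁺`. A jump may overshoot time `n` only from the
last `N` positions, where `(f 1)⁺` is charged at every step. -/
theorem le_sum_badSet (hf : IsSubadditiveCocycle T f) (N n : ℕ) (ω : Ω) :
    f n ω ≤ ∑ i ∈ Finset.range n, ((badSet f N).indicator (fun ω => max (f 1 ω) 0) (T^[i] ω) +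
      if n ≤ i + N then max (f 1 (T^[i] ω)) 0 else 0) := by
  classical
  set φ := (badSet f N).indicator (fun ω => max (f 1 ω) 0) with hφ
  have hφ0 : ∀ ω, 0 ≤ φ ω := fun ω => Set.indicator_nonneg (fun _ _ => le_max_right _ _) _
  have hterm : ∀ n i ω, 0 ≤ φ (T^[i] ω) + if n ≤ i + N then max (f 1 (T^[i] ω)) 0 else 0 := by
    intro n i ω
    have := hφ0 (T^[i] ω)
    split_ifs <;> positivity
  induction n using Nat.strong_induction_on generalizing ω with
  | _ n ih =>
  rcases Nat.eq_zero_or_pos n with rfl | hn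
  · simpa using hf.zero_le ω
  have step : ∀ k, 1 ≤ k → k ≤ n → f n ω ≤ f k ω + ∑ i ∈ Finset.range (n - k),
      (φ (T^[k + i] ω) + if n ≤ k + i + N then max (f 1 (T^[k + i] ω)) 0 else 0) := by
    intro k hk hkn
    have h1 := hf.add_le k (n - k) ω
    rw [Nat.add_sub_cancel' hkn] at h1
    refine h1.trans (add_le_add le_rfl ((ih (n - k) (by omega) (T^[k] ω)).trans (le_of_eq ?_)))
    refine Finset.sum_congr rfl fun i _ => ?_
    rw [← Function.iterate_add_apply, add_comm i k]
    congr 1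
    have : n - k ≤ i + N ↔ n ≤ k + i + N := by omega
    simp only [this]
  have split : ∀ k, k ≤ n → ∀ g : ℕ → ℝ, ∑ i ∈ Finset.range n, g i =
      ∑ i ∈ Finset.range k, g i + ∑ i ∈ Finset.range (n - k), g (k + i) := by
    intro k hk g
    conv_lhs => rw [← Nat.add_sub_cancel' hk, Finset.sum_range_add]
  by_cases hb : ω ∈ badSet f N
  · rw [split 1 hn]
    refine (step 1 le_rfl hn).trans (add_le_add ?_ le_rfl)
    simp only [Finset.sum_range_one, Function.iterate_zero, id]
    rw [hφ, Set.indicator_of_mem hb]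
    have := le_max_left (f 1 ω) 0
    have := le_max_right (f 1 ω) 0
    split_ifs <;> linarith
  · simp only [badSet, Set.mem_ofPred_eq, not_forall, not_lt] at hb
    obtain ⟨k, hk1, hkN, hk⟩ := hb
    rcases le_or_gt k n with hkn | hkn
    · rw [split k hkn]
      have h0 := Finset.sum_nonneg (s := Finset.range k) fun i _ => hterm n i ω
      have := step k hk1 hkn
      linarith
    -- Here `n < k ≤ N`, so every time `i < n` lies in the final window and the trivial bound
    -- suffices.
    · refine (hf.le_birkhoffSum n ω).trans (Finset.sum_le_sum fun i _ => ?_)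
      rw [if_pos (by omega)]
      have := hφ0 (T^[i] ω)
      linarith

variable [MeasurableSpace Ω] {P : Measure Ω}

theorem nullMeasurableSet_badSet (hint : ∀ n, Integrable (f n) P) (N : ℕ) :
    NullMeasurableSet (badSet f N) P := by
  have : badSet f N = ⋂ n : ℕ, ⋂ _ : 1 ≤ n, ⋂ _ : n ≤ N, {ω | 0 < f n ω} := by
    ext; simp [badSet]
  rw [this]
  refine .iInter fun n => .iInter fun _ => .iInter fun _ => ?_
  exact nullMeasurableSet_lt aemeasurable_const (hint n).aemeasurable

theorem integral_le_badSet (hT : MeasurePreserving T P P) (hf : IsSubadditiveCocycle T f)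
    (hint : ∀ n, Integrable (f n) P) (N n : ℕ) :
    ∫ ω, f n ω ∂P ≤ n * ∫ ω, (badSet f N).indicator (fun ω => max (f 1 ω) 0) ω ∂P +
      N * ∫ ω, max (f 1 ω) 0 ∂P := by
  classical
  have hu : Integrable (fun ω => max (f 1 ω) 0) P := (hint 1).pos_part
  have hφ : Integrable ((badSet f N).indicator (fun ω => max (f 1 ω) 0)) P :=
    hu.indicator₀ (nullMeasurableSet_badSet hint N)
  have hcomp : ∀ (g : Ω → ℝ), Integrable g P → ∀ i, Integrable (fun ω => g (T^[i] ω)) P ∧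
      ∫ ω, g (T^[i] ω) ∂P = ∫ ω, g ω ∂P := fun g hg i =>
    ⟨(hT.iterate i).integrable_comp_of_integrable hg, integral_comp_iterate hT hg i⟩
  have hite : ∀ i, Integrable (fun ω => if n ≤ i + N then max (f 1 (T^[i] ω)) 0 else 0) P := by
    intro i
    split_ifs
    · exact (hcomp _ hu i).1
    · simp
  have hmain := integral_mono (hint n) (integrable_finsetSum (Finset.range n)
    fun i _ => ((hcomp _ hφ i).1.add (hite i))) (fun ω => hf.le_sum_badSet N n ω)
  refine hmain.trans ?_
  have e : ∀ i, ∫ ω, ((badSet f N).indicator (fun ω => max (f 1 ω) 0) (T^[i] ω) +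
      if n ≤ i + N then max (f 1 (T^[i] ω)) 0 else 0) ∂P =
      ∫ ω, (badSet f N).indicator (fun ω => max (f 1 ω) 0) ω ∂P +
      if n ≤ i + N then ∫ ω, max (f 1 ω) 0 ∂P else 0 := by
    intro i
    rw [integral_add (hcomp _ hφ i).1 (hite i), (hcomp _ hφ i).2]
    split_ifs
    · rw [(hcomp _ hu i).2]
    · simp
  rw [integral_finsetSum _ fun i _ => ((hcomp _ hφ i).1.add (hite i))]
  simp only [Pi.add_apply, e]
  rw [Finset.sum_add_distrib, Finset.sum_const, Finset.card_range, nsmul_eq_mul,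
    ← Finset.sum_filter, Finset.sum_const, nsmul_eq_mul]
  gcongr
  · calc (Finset.filter (fun i => n ≤ i + N) (Finset.range n)).card
        ≤ (Finset.Ico (n - N) n).card := Finset.card_le_card fun i hi => by
          simp only [Finset.mem_filter, Finset.mem_range, Finset.mem_Ico] at hi ⊢; omega
      _ ≤ N := by rw [Nat.card_Ico]; omega

/-- If almost every orbit starts with a nonpositive value, the growth rate of the means is at
most zero. -/
theorem exists_integral_le_of_ae_exists_nonpos (hT : MeasurePreserving T P P)
    (hf : IsSubadditiveCocycle T f) (hint : ∀ n, Integrable (f n) P)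
    (h : ∀ᵐ ω ∂P, ∃ n, 1 ≤ n ∧ f n ω ≤ 0) {ε : ℝ} (hε : 0 < ε) :
    ∃ n : ℕ, 1 ≤ n ∧ ∫ ω, f n ω ∂P ≤ ε * n := by
  have hu : Integrable (fun ω => max (f 1 ω) 0) P := (hint 1).pos_part
  -- The bad sets shrink to a null set, so the cost per unit time vanishes as `N → ∞`; with `N`
  -- fixed, the end cost is then negligible for large `n`.
  have hlim : Tendsto
      (fun N => ∫ ω, (badSet f N).indicator (fun ω => max (f 1 ω) 0) ω ∂P) atTop (𝓝 0) := by
    have := tendsto_integral_of_dominated_convergence (μ := P) (f := fun _ => (0 : ℝ))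
      (F := fun N => (badSet f N).indicator (fun ω => max (f 1 ω) 0)) (fun ω => max (f 1 ω) 0)
      (fun N => (hu.indicator₀ (nullMeasurableSet_badSet hint N)).1) hu ?_ ?_
    · simpa using this
    · refine fun N => .of_forall fun ω => ?_
      by_cases hω : ω ∈ badSet f N
      · rw [Set.indicator_of_mem hω, Real.norm_of_nonneg (le_max_right _ _)]
      · simp [hω]
    · filter_upwards [h] with ω ⟨k, hk1, hk⟩
      refine tendsto_const_nhds.congr' ?_
      filter_upwards [eventually_ge_atTop k] with N hN
      rw [Set.indicator_of_notMem]
      exact fun hb => (hb k hk1 hN).not_ge hk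
  obtain ⟨N, hN⟩ := (hlim.eventually (gt_mem_nhds (half_pos hε))).exists
  have hlim2 : Tendsto (fun n : ℕ => (N * ∫ ω, max (f 1 ω) 0 ∂P) / (n : ℝ)) atTop (𝓝 0) :=
    tendsto_const_div_atTop_nhds_zero_nat _
  obtain ⟨n, hn, hn1⟩ := ((hlim2.eventually (gt_mem_nhds (half_pos hε))).and
    (eventually_ge_atTop 1)).exists
  refine ⟨n, hn1, (hf.integral_le_badSet hT hint N n).trans ?_⟩
  have hn0 : (0 : ℝ) < n := by exact_mod_cast hn1
  rw [div_lt_iff₀ hn0] at hn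
  nlinarith

variable [IsProbabilityMeasure P]

/-- Lower half of Kingman's theorem. The event that `f n / n` is infinitely often below `d` by a
fixed margin is backward invariant by subadditivity, hence null or conull. If it were conull, `f n -
d * n` would almost surely reach a nonpositive value, forcing means below `c * n`. -/
theorem ae_eventually_lt (hT : Ergodic T P) (hf : IsSubadditiveCocycle T f)
    (hint : ∀ n, Integrable (f n) P) {c : ℝ} (hc : ∀ n : ℕ, 1 ≤ n → c * n ≤ ∫ ω, f n ω ∂P)
    {c₀ : ℝ} (hc₀ : c₀ < c) : ∀ᵐ ω ∂P, ∀ᶠ n : ℕ in atTop, c₀ * n < f n ω := by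
  obtain ⟨d, hd0, hdc⟩ := exists_between hc₀
  set G : Set Ω := {ω | ∃ k : ℕ, ∃ᶠ n : ℕ in atTop, f n ω ≤ (d - 1 / ((k : ℝ) + 1)) * n} with hG
  have hGm : NullMeasurableSet G P := by
    have : G = ⋃ k : ℕ, ⋂ a : ℕ, ⋃ n : ℕ, ⋃ _ : a ≤ n,
        {ω | f n ω ≤ (d - 1 / ((k : ℝ) + 1)) * n} := by
      ext ω; simp [hG, Filter.frequently_atTop]
    rw [this]
    refine .iUnion fun k => .iInter fun a => .iUnion fun n => .iUnion fun _ => ?_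
    exact nullMeasurableSet_le (hint n).aemeasurable aemeasurable_const
  have hGT : T ⁻¹' G ⊆ G := by
    rintro ω ⟨k, hk⟩
    -- Passing from margin `1/(k+1)` to `1/(k+2)` leaves room, growing linearly in `n`, to absorb
    -- the extra term `f 1 ω`.
    refine ⟨k + 1, ?_⟩
    have hgap : 0 < 1 / ((k : ℝ) + 1) - 1 / (((k + 1 : ℕ) : ℝ) + 1) := by
      rw [sub_pos]
      refine one_div_lt_one_div_of_lt (by positivity) ?_
      push_cast; linarith
    set δ := 1 / ((k : ℝ) + 1) - 1 / (((k + 1 : ℕ) : ℝ) + 1) with hδ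
    have hlarge : ∀ᶠ n : ℕ in atTop, f 1 ω - (d - 1 / (((k + 1 : ℕ) : ℝ) + 1)) ≤ δ * n :=
      (tendsto_natCast_atTop_atTop.const_mul_atTop hgap).eventually_ge_atTop _
    have hfreq : ∃ᶠ n : ℕ in atTop,
        f (n + 1) ω ≤ (d - 1 / (((k + 1 : ℕ) : ℝ) + 1)) * ((n + 1 : ℕ) : ℝ) := by
      refine (hk.and_eventually hlarge).mono ?_
      rintro n ⟨h1, h2⟩
      have h3 := hf.add_le 1 n ω
      rw [add_comm 1 n] at h3
      simp only [Function.iterate_one] at h3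
      push_cast at h1 h2 h3 ⊢
      have : δ * n = (1 / ((k : ℝ) + 1)) * n - 1 / (((k + 1 : ℕ) : ℝ) + 1) * n := by
        rw [hδ]; ring
      push_cast at this
      nlinarith
    exact (tendsto_add_atTop_nat 1).frequently hfreq
  rcases hT.ae_empty_or_univ_of_preimage_ae_le hGm (LE.le.eventuallyLE hGT) with h | h
  · filter_upwards [h.mem_iff] with ω hω
    simp only [Set.mem_empty_iff_false, iff_false, hG, Set.mem_ofPred_eq, not_exists,
      Filter.not_frequently, not_le] at hω
    obtain ⟨k, hk⟩ := exists_nat_one_div_lt (sub_pos.2 hd0)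
    filter_upwards [hω k] with n hn
    refine lt_of_le_of_lt ?_ hn
    gcongr
    linarith
  · exfalso
    have hg : IsSubadditiveCocycle T (fun n ω => f n ω - d * n) := by
      refine ⟨fun ω => by simpa using hf.zero_le ω, fun m n ω => ?_⟩
      have := hf.add_le m n ω
      push_cast
      linarith
    have hgint : ∀ n : ℕ, Integrable (fun ω => f n ω - d * n) P := fun n =>
      (hint n).sub (integrable_const _)
    obtain ⟨n, hn1, hn⟩ := hg.exists_integral_le_of_ae_exists_nonpos hT.toMeasurePreserving
      hgint (by
        filter_upwards [h.mem_iff] with ω hω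
        obtain ⟨k, hk⟩ := hω.2 trivial
        obtain ⟨n, hn, hn1⟩ := (hk.and_eventually (eventually_ge_atTop 1)).exists
        refine ⟨n, hn1, ?_⟩
        have : 0 < 1 / ((k : ℝ) + 1) * n := by
          have : (0 : ℝ) < n := by exact_mod_cast hn1
          positivity
        nlinarith) (half_pos (sub_pos.2 hdc))
    have h1 := hc n hn1
    rw [integral_sub (hint n) (integrable_const _)] at hn
    simp only [integral_const, probReal_univ, one_smul] at hn
    have : (0 : ℝ) < n := by exact_mod_cast hn1
    nlinarith

end IsSubadditiveCocycle

/-! ### Birkhoff's theorem, from the one-sided bound applied to `g` and `-g` -/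

section Birkhoff

variable {Ω : Type*} {T : Ω → Ω} [MeasurableSpace Ω] {P : Measure Ω}

theorem integrable_birkhoffSum (hT : MeasurePreserving T P P) {g : Ω → ℝ} (hg : Integrable g P)
    (n : ℕ) : Integrable (birkhoffSum T g n) P := by
  unfold birkhoffSum
  exact integrable_finsetSum _ fun i _ => (hT.iterate i).integrable_comp_of_integrable hg

theorem integral_birkhoffSum (hT : MeasurePreserving T P P) {g : Ω → ℝ} (hg : Integrable g P)
    (n : ℕ) : ∫ ω, birkhoffSum T g n ω ∂P = n * ∫ ω, g ω ∂P := by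
  unfold birkhoffSum
  rw [integral_finsetSum (f := fun i ω => g (T^[i] ω)) _
    fun i _ => (hT.iterate i).integrable_comp_of_integrable hg]
  simp [integral_comp_iterate hT hg]

variable [IsProbabilityMeasure P]

theorem ae_eventually_lt_birkhoffSum (hT : Ergodic T P) {g : Ω → ℝ} (hg : Integrable g P)
    {c : ℝ} (hc : c < ∫ ω, g ω ∂P) :
    ∀ᵐ ω ∂P, ∀ᶠ n : ℕ in atTop, c * n < birkhoffSum T g n ω := by
  have hS : IsSubadditiveCocycle T (fun n ω => birkhoffSum T g n ω) :=
    ⟨fun ω => by simp, fun m n ω => (birkhoffSum_add T g m n ω).le⟩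
  refine hS.ae_eventually_lt hT (integrable_birkhoffSum hT.toMeasurePreserving hg)
    (c := ∫ ω, g ω ∂P) (fun n _ => ?_) hc
  rw [integral_birkhoffSum hT.toMeasurePreserving hg, mul_comm]

/-- **Birkhoff's ergodic theorem** for an ergodic map. -/
theorem ae_tendsto_birkhoffSum_div (hT : Ergodic T P) {g : Ω → ℝ} (hg : Integrable g P) :
    ∀ᵐ ω ∂P, Tendsto (fun n : ℕ => birkhoffSum T g n ω / n) atTop (𝓝 (∫ ω, g ω ∂P)) := by
  have h1 : ∀ k : ℕ, ∀ᵐ ω ∂P, ∀ᶠ n : ℕ in atTop,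
      (∫ ω, g ω ∂P - 1 / ((k : ℝ) + 1)) * n < birkhoffSum T g n ω := fun k =>
    ae_eventually_lt_birkhoffSum hT hg (by
      have : 0 < 1 / ((k : ℝ) + 1) := by positivity
      linarith)
  have h2 : ∀ k : ℕ, ∀ᵐ ω ∂P, ∀ᶠ n : ℕ in atTop,
      (-∫ ω, g ω ∂P - 1 / ((k : ℝ) + 1)) * n < birkhoffSum T (-g) n ω := fun k =>
    ae_eventually_lt_birkhoffSum hT hg.neg (by
      have : 0 < 1 / ((k : ℝ) + 1) := by positivity
      simp only [Pi.neg_apply, integral_neg]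
      linarith)
  filter_upwards [ae_all_iff.2 h1, ae_all_iff.2 h2] with ω hω1 hω2
  refine tendsto_order.2 ⟨fun a ha => ?_, fun a ha => ?_⟩
  · obtain ⟨k, hk⟩ := exists_nat_one_div_lt (sub_pos.2 ha)
    filter_upwards [hω1 k, eventually_gt_atTop 0] with n hn hn0
    have hn0' : (0 : ℝ) < n := by exact_mod_cast hn0
    rw [lt_div_iff₀ hn0']
    nlinarith
  · obtain ⟨k, hk⟩ := exists_nat_one_div_lt (sub_pos.2 ha)
    filter_upwards [hω2 k, eventually_gt_atTop 0] with n hn hn0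
    have hn0' : (0 : ℝ) < n := by exact_mod_cast hn0
    rw [div_lt_iff₀ hn0']
    have : birkhoffSum T (-g) n ω = - birkhoffSum T g n ω := by simp [birkhoffSum]
    rw [this] at hn
    nlinarith

end Birkhoff

theorem tendsto_natDiv_div_atTop {m : ℕ} (hm : 1 ≤ m) :
    Tendsto (fun n : ℕ => ((n / m : ℕ) : ℝ) / n) atTop (𝓝 (1 / (m : ℝ))) := by
  have h := (tendsto_nat_floor_mul_div_atTop (R := ℝ) (a := 1 / (m : ℝ)) (by positivity)).comp
    (tendsto_natCast_atTop_atTop (R := ℝ))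
  refine h.congr fun n => ?_
  simp only [Function.comp]
  rw [one_div_mul_eq_div, Nat.floor_div_eq_div]

/-! ### The upper half of Kingman's theorem -/

namespace IsSubadditiveCocycle

variable {Ω : Type*} {T : Ω → Ω} {f : ℕ → Ω → ℝ}

theorem mul_le_birkhoffSum (hf : IsSubadditiveCocycle T f) (m q : ℕ) (ω : Ω) :
    f (m * q) ω ≤ birkhoffSum T^[m] (f m) q ω := by
  induction q generalizing ω with
  | zero => simpa using hf.zero_le ω
  | succ q ih =>
    rw [birkhoffSum_succ', Nat.mul_succ, add_comm]
    exact (hf.add_le _ _ _).trans (add_le_add le_rfl (ih _))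

/-- Division with remainder. The remainder is written as a difference of Birkhoff sums of `(f 1)⁺`
so that Birkhoff's theorem makes it `o(n)` without separate control of the leftover block. -/
theorem le_birkhoffSum_iterate (hf : IsSubadditiveCocycle T f) (m n : ℕ) (ω : Ω) :
    f n ω ≤ birkhoffSum T^[m] (f m) (n / m) ω +
      (birkhoffSum T (fun ω => max (f 1 ω) 0) n ω -
        birkhoffSum T (fun ω => max (f 1 ω) 0) (m * (n / m)) ω) := by
  have h1 := hf.add_le (m * (n / m)) (n % m) ω
  have h2 := hf.mul_le_birkhoffSum m (n / m) ω
  have h3 := hf.le_birkhoffSum (n % m) (T^[m * (n / m)] ω)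
  have h4 := birkhoffSum_add T (fun ω => max (f 1 ω) 0) (m * (n / m)) (n % m) ω
  rw [Nat.div_add_mod] at h1 h4
  linarith

variable [MeasurableSpace Ω] {P : Measure Ω} [IsProbabilityMeasure P]

theorem ae_eventually_gt (hT : ∀ m, 1 ≤ m → Ergodic T^[m] P) (hf : IsSubadditiveCocycle T f)
    (hint : ∀ n, Integrable (f n) P) {m : ℕ} (hm : 1 ≤ m) :
    ∀ᵐ ω ∂P, ∀ c : ℝ, (∫ ω, f m ω ∂P) / m < c → ∀ᶠ n : ℕ in atTop, f n ω / n < c := by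
  have hT1 : Ergodic T P := by simpa using hT 1 le_rfl
  have hm0 : (m : ℝ) ≠ 0 := by positivity
  filter_upwards [ae_tendsto_birkhoffSum_div (hT m hm) (hint m),
    ae_tendsto_birkhoffSum_div hT1 (hint 1).pos_part] with ω h1 h2 c hc
  have hq : Tendsto (fun n : ℕ => n / m) atTop atTop :=
    Nat.tendsto_div_const_atTop (by omega)
  have hmq : Tendsto (fun n : ℕ => m * (n / m)) atTop atTop :=
    hq.const_mul_atTop' (by omega)
  have hd := tendsto_natDiv_div_atTop hm
  have e1 := (h1.comp hq).mul hd
  have e2 := (h2.comp hmq).mul (hd.const_mul (m : ℝ))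
  have e3 := e1.add (h2.sub e2)
  -- The two Birkhoff averages of `(f 1)⁺` cancel in the limit because `m * (n / m)` is asymptotic
  -- to `n`.
  have hlim : (∫ ω, f m ω ∂P) * (1 / (m : ℝ)) + (∫ ω, max (f 1 ω) 0 ∂P -
      (∫ ω, max (f 1 ω) 0 ∂P) * (m * (1 / (m : ℝ)))) < c := by
    rw [mul_one_div_cancel hm0, mul_one, sub_self, add_zero, mul_one_div]
    exact hc
  filter_upwards [e3.eventually (gt_mem_nhds hlim), eventually_ge_atTop m] with n hn hnm
  refine lt_of_le_of_lt ?_ hn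
  have hn0 : (n : ℝ) ≠ 0 := by
    have : 0 < n := by omega
    positivity
  have hq0 : ((n / m : ℕ) : ℝ) ≠ 0 := by
    have : 0 < n / m := Nat.div_pos hnm (by omega)
    positivity
  calc f n ω / n ≤ (birkhoffSum T^[m] (f m) (n / m) ω +
      (birkhoffSum T (fun ω => max (f 1 ω) 0) n ω -
        birkhoffSum T (fun ω => max (f 1 ω) 0) (m * (n / m)) ω)) / n := by
        gcongr; exact hf.le_birkhoffSum_iterate m n ω
    _ = _ := by
      simp only [Function.comp]
      push_cast
      field_simp

/-- **Kingman's subadditive ergodic theorem** for a map all of whose powers are ergodic. -/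
theorem ae_tendsto_div (hT : ∀ m, 1 ≤ m → Ergodic T^[m] P) (hf : IsSubadditiveCocycle T f)
    (hint : ∀ n, Integrable (f n) P) {c : ℝ} (hc : ∀ n : ℕ, 1 ≤ n → c ≤ (∫ ω, f n ω ∂P) / n)
    (hlim : Tendsto (fun n : ℕ => (∫ ω, f n ω ∂P) / n) atTop (𝓝 c)) :
    ∀ᵐ ω ∂P, Tendsto (fun n : ℕ => f n ω / n) atTop (𝓝 c) := by
  have hT1 : Ergodic T P := by simpa using hT 1 le_rfl
  have h1 : ∀ k : ℕ, ∀ᵐ ω ∂P, ∀ᶠ n : ℕ in atTop, (c - 1 / ((k : ℝ) + 1)) * n < f n ω := fun k =>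
    hf.ae_eventually_lt hT1 hint (fun n hn => (le_div_iff₀ (by positivity)).1 (hc n hn)) (by
      have : 0 < 1 / ((k : ℝ) + 1) := by positivity
      linarith)
  have h2 : ∀ᵐ ω ∂P, ∀ m : ℕ, 1 ≤ m → ∀ c : ℝ, (∫ ω, f m ω ∂P) / m < c →
      ∀ᶠ n : ℕ in atTop, f n ω / n < c := by
    refine ae_all_iff.2 fun m => ?_
    by_cases hm : 1 ≤ m
    · filter_upwards [hf.ae_eventually_gt hT hint hm] with ω hω _ using hω
    · exact .of_forall fun _ h => absurd h hm
  filter_upwards [ae_all_iff.2 h1, h2] with ω hω1 hω2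
  refine tendsto_order.2 ⟨fun a ha => ?_, fun a ha => ?_⟩
  · obtain ⟨k, hk⟩ := exists_nat_one_div_lt (sub_pos.2 ha)
    filter_upwards [hω1 k, eventually_gt_atTop 0] with n hn hn0
    have hn0' : (0 : ℝ) < n := by exact_mod_cast hn0
    rw [lt_div_iff₀ hn0']
    nlinarith
  · obtain ⟨m, hm, hm1⟩ := ((hlim.eventually (gt_mem_nhds ha)).and (eventually_ge_atTop 1)).exists
    exact hω2 m hm1 a hm

end IsSubadditiveCocycle

/-! ### Ergodicity of the Bernoulli shift -/

section Shift

variable {S : Type*}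

/-- The shift on the path space `S^ℕ`. -/
def pathShift (ω : ℕ → S) : ℕ → S := fun n => ω (n + 1)

theorem iterate_pathShift (m : ℕ) (ω : ℕ → S) : pathShift^[m] ω = fun n => ω (n + m) := by
  induction m generalizing ω with
  | zero => rfl
  | succ m ih =>
    rw [Function.iterate_succ_apply, ih]
    funext n
    simp only [pathShift]
    congr 1

variable [MeasurableSpace S]

theorem measurable_pathShift : Measurable (pathShift : (ℕ → S) → ℕ → S) :=
  measurable_pi_iff.2 fun n => measurable_pi_apply (n + 1)

variable (μ : Measure S) [IsProbabilityMeasure μ]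

instance : IsProbabilityMeasure (pathMeasure μ) := by
  unfold pathMeasure; infer_instance

theorem measurePreserving_pathShift :
    MeasurePreserving (pathShift : (ℕ → S) → ℕ → S) (pathMeasure μ) (pathMeasure μ) := by
  refine ⟨measurable_pathShift, ?_⟩
  refine Measure.eq_infinitePi _ fun s t ht => ?_
  rw [Measure.map_apply measurable_pathShift (MeasurableSet.pi s.countable_toSet fun i _ => ht i)]
  have : pathShift ⁻¹' (s : Set ℕ).pi t =
      ((s.map (addRightEmbedding 1) : Finset ℕ) : Set ℕ).pi fun i => t (i - 1) := by
    ext ω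
    simp [Set.mem_pi, pathShift]
  rw [this, pathMeasure, Measure.infinitePi_pi _ (fun i _ => ht _)]
  simp

/-- Kolmogorov's zero-one law: a strictly invariant set is a tail event of the independent
coordinates. -/
theorem ergodic_iterate_pathShift {m : ℕ} (hm : 1 ≤ m) :
    Ergodic (pathShift : (ℕ → S) → ℕ → S)^[m] (pathMeasure μ) := by
  refine ⟨(measurePreserving_pathShift μ).iterate m, ⟨fun s hs hinv => ?_⟩⟩
  have hindep : ProbabilityTheory.iIndep
      (fun n : ℕ => MeasurableSpace.comap (fun ω : ℕ → S => ω n) inferInstance) (pathMeasure μ) :=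
    ProbabilityTheory.iIndepFun_infinitePi (P := fun _ : ℕ => μ) (X := fun _ x => x)
      (fun _ => measurable_id)
  have hle : ∀ n : ℕ, MeasurableSpace.comap (fun ω : ℕ → S => ω n) inferInstance ≤
      (inferInstance : MeasurableSpace (ℕ → S)) := fun n => (measurable_pi_apply n).comap_le
  have htail : MeasurableSet[limsup
      (fun n : ℕ => MeasurableSpace.comap (fun ω : ℕ → S => ω n) inferInstance) atTop] s := by
    rw [limsup_eq_iInf_iSup_of_nat, MeasurableSpace.measurableSet_iInf]
    intro k
    -- The set equals its own preimage under the `m * k`-fold shift, which sees only coordinates of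
    -- index at least `m * k ≥ k`.
    have hk : (pathShift^[m])^[k] ⁻¹' s = s := by
      induction k with
      | zero => rfl
      | succ k ih =>
        rw [Function.iterate_succ, Set.preimage_comp, ih, hinv]
    rw [← hk]
    have hmeas : @Measurable _ _ (⨆ n ≥ k,
        MeasurableSpace.comap (fun ω : ℕ → S => ω n) inferInstance) _
        ((pathShift : (ℕ → S) → ℕ → S)^[m])^[k] := by
      refine @measurable_pi_iff _ _ _ (_) _ _ |>.2 fun n => ?_
      have e : (fun ω : ℕ → S => (pathShift^[m])^[k] ω n) = fun ω => ω (n + m * k) := by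
        funext ω
        rw [← Function.iterate_mul, iterate_pathShift]
      rw [e]
      refine Measurable.mono (comap_measurable (fun ω : ℕ → S => ω (n + m * k))) ?_ le_rfl
      exact le_iSup₂_of_le (n + m * k) (by nlinarith) le_rfl
    exact hmeas hs
  rcases ProbabilityTheory.measure_zero_or_one_of_measurableSet_limsup_atTop hle hindep htail
    with h | h
  · exact eventuallyConst_set'.2 (.inl (ae_eq_empty.2 h))
  · exact eventuallyConst_set'.2 (.inr (ae_eq_univ.2 ((prob_compl_eq_zero_iff hs).2 h)))

end Shift

/-! ### The Lyapunov exponent of a submultiplicative cocycle -/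

theorem extLog_of_pos {r : ℝ} (hr : 0 < r) : extLog r = (Real.log r : EReal) :=
  ENNReal.log_ofReal_of_pos hr

theorem extLog_zero : extLog 0 = ⊥ := by simp [extLog]

/-- The logarithm of `N n`, truncated from below at `-M n`. -/
noncomputable def truncLog {Ω : Type*} (N : ℕ → Ω → ℝ) (M n : ℕ) (ω : Ω) : ℝ :=
  Real.log (max (N n ω) (Real.exp (-((M : ℝ) * n))))

/-- A nonnegative submultiplicative cocycle over the map `T`. -/
structure IsSubmultiplicativeCocycle {Ω : Type*} (T : Ω → Ω) (N : ℕ → Ω → ℝ) : Prop where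
  nonneg : ∀ n ω, 0 ≤ N n ω
  zero_le : ∀ ω, N 0 ω ≤ 1
  mul_le : ∀ m n ω, N (m + n) ω ≤ N m ω * N n (T^[m] ω)

section TruncLog

variable {Ω : Type*} {N : ℕ → Ω → ℝ}

theorem truncLog_pos_arg (M n : ℕ) (ω : Ω) : 0 < max (N n ω) (Real.exp (-((M : ℝ) * n))) :=
  lt_max_of_lt_right (Real.exp_pos _)

theorem neg_mul_le_truncLog (M n : ℕ) (ω : Ω) : -((M : ℝ) * n) ≤ truncLog N M n ω := by
  rw [truncLog, Real.le_log_iff_exp_le (truncLog_pos_arg M n ω)]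
  exact le_max_right _ _

theorem truncLog_anti (n : ℕ) (ω : Ω) : Antitone fun M => truncLog N M n ω := by
  intro M M' h
  refine Real.log_le_log (truncLog_pos_arg M' n ω) (max_le_max le_rfl (Real.exp_le_exp.2 ?_))
  gcongr

theorem truncLog_zero_eq_posLog {n : ℕ} {ω : Ω} (h : 0 ≤ N n ω) :
    truncLog N 0 n ω = Real.posLog (N n ω) := by
  rw [truncLog, Real.posLog_eq_log_max_one h, max_comm]
  simp

theorem truncLog_of_le {M n : ℕ} {ω : Ω} (h : N n ω ≤ Real.exp (-((M : ℝ) * n))) :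
    truncLog N M n ω = -((M : ℝ) * n) := by
  rw [truncLog, max_eq_right h, Real.log_exp]

theorem truncLog_of_ge {M n : ℕ} {ω : Ω} (h : Real.exp (-((M : ℝ) * n)) ≤ N n ω) :
    truncLog N M n ω = Real.log (N n ω) := by
  rw [truncLog, max_eq_left h]

theorem extLog_le_truncLog (M n : ℕ) (ω : Ω) :
    extLog (N n ω) ≤ (truncLog N M n ω : EReal) := by
  rw [truncLog, ← extLog_of_pos (truncLog_pos_arg M n ω)]
  exact ENNReal.log_monotone (ENNReal.ofReal_le_ofReal (le_max_left _ _))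

/-- The truncation level is at most `1`, so it never touches the positive part of the logarithm;
only the negative part depends on `M`. -/
theorem ofReal_truncLog (M n : ℕ) (ω : Ω) :
    ENNReal.ofReal (truncLog N M n ω) = (extLog (N n ω)).toENNReal := by
  rcases le_or_gt (N n ω) 0 with h0 | h0
  · rw [truncLog_of_le (h0.trans (Real.exp_pos _).le), extLog, ENNReal.ofReal_of_nonpos h0]
    rw [ENNReal.log_zero, EReal.toENNReal_bot, ENNReal.ofReal_of_nonpos]
    have : 0 ≤ (M : ℝ) * n := by positivity
    linarith
  rw [extLog_of_pos h0, EReal.toENNReal_of_ne_top (EReal.coe_ne_top _), EReal.toReal_coe]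
  rcases le_total (Real.exp (-((M : ℝ) * n))) (N n ω) with h | h
  · rw [truncLog_of_ge h]
  · have hM : 0 ≤ (M : ℝ) * n := by positivity
    rw [truncLog_of_le h, ENNReal.ofReal_of_nonpos (by linarith), ENNReal.ofReal_of_nonpos]
    refine Real.log_nonpos h0.le (h.trans (Real.exp_le_one_iff.2 (by linarith)))

theorem tendsto_ofReal_neg_truncLog {n : ℕ} (hn : 1 ≤ n) {ω : Ω} (h : 0 ≤ N n ω) :
    Tendsto (fun M => ENNReal.ofReal (-truncLog N M n ω)) atTop
      (𝓝 (-extLog (N n ω)).toENNReal) := by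
  have hn0 : (0 : ℝ) < n := by exact_mod_cast hn
  rcases h.eq_or_lt with h0 | h0
  · have e : ∀ M : ℕ, truncLog N M n ω = -((M : ℝ) * n) := fun M =>
      truncLog_of_le (h0 ▸ (Real.exp_pos _).le)
    simp only [e, neg_neg, ← h0, extLog_zero, EReal.neg_bot, EReal.toENNReal_top]
    exact ENNReal.tendsto_ofReal_nhds_top.2 (tendsto_natCast_atTop_atTop.atTop_mul_const hn0)
  · refine tendsto_const_nhds.congr' ?_
    have hlim : Tendsto (fun M : ℕ => Real.exp (-((M : ℝ) * n))) atTop (𝓝 0) :=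
      Real.tendsto_exp_neg_atTop_nhds_zero.comp
        (tendsto_natCast_atTop_atTop.atTop_mul_const hn0)
    filter_upwards [hlim.eventually (gt_mem_nhds h0)] with M hM
    rw [truncLog_of_ge hM.le, extLog_of_pos h0, ← EReal.coe_neg,
      EReal.toENNReal_of_ne_top (EReal.coe_ne_top _), EReal.toReal_coe]

variable [MeasurableSpace Ω] {P : Measure Ω}

/-- The expectation of the extended logarithm is the limit of the expectations of the truncated
logarithms. -/
theorem tendsto_integral_truncLog {n : ℕ} (hn : 1 ≤ n) (hnn : ∀ ω, 0 ≤ N n ω)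
    (hint : ∀ M, Integrable (truncLog N M n) P) :
    Tendsto (fun M => ((∫ ω, truncLog N M n ω ∂P : ℝ) : EReal)) atTop
      (𝓝 (extExpectation P fun ω => extLog (N n ω))) := by
  have hfin : ∀ {g : Ω → ℝ}, Integrable g P → ∫⁻ ω, ENNReal.ofReal (g ω) ∂P ≠ ⊤ := fun hg =>
    hg.lintegral_lt_top.ne
  have e : ∀ M, ((∫ ω, truncLog N M n ω ∂P : ℝ) : EReal) =
      ((∫⁻ ω, (extLog (N n ω)).toENNReal ∂P : ℝ≥0∞) : EReal) +
        -((∫⁻ ω, ENNReal.ofReal (-truncLog N M n ω) ∂P : ℝ≥0∞) : EReal) := by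
    intro M
    rw [integral_eq_lintegral_pos_part_sub_lintegral_neg_part (hint M), EReal.coe_sub,
      EReal.coe_ennreal_toReal (hfin (hint M)), EReal.coe_ennreal_toReal (hfin (hint M).fun_neg),
      ← sub_eq_add_neg]
    simp only [ofReal_truncLog]
  have hp : ∫⁻ ω, (extLog (N n ω)).toENNReal ∂P ≠ ⊤ := by
    have := hfin (hint 0)
    simpa only [ofReal_truncLog] using this
  have hlim : Tendsto (fun M => ∫⁻ ω, ENNReal.ofReal (-truncLog N M n ω) ∂P) atTop
      (𝓝 (∫⁻ ω, (-extLog (N n ω)).toENNReal ∂P)) := by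
    refine lintegral_tendsto_of_tendsto_of_monotone
      (fun M => (hint M).aemeasurable.neg.ennreal_ofReal) (.of_forall fun ω M M' h => ?_)
      (.of_forall fun ω => tendsto_ofReal_neg_truncLog hn (hnn ω))
    exact ENNReal.ofReal_le_ofReal (neg_le_neg (truncLog_anti n ω h))
  have hlim' := (continuous_neg.tendsto _).comp
    ((continuous_coe_ennreal_ereal.tendsto _).comp hlim)
  simp only [e]
  rw [extExpectation, sub_eq_add_neg]
  -- Addition is continuous here because the positive part has finite integral, which rules out `⊤ +
  -- ⊥`.
  refine (EReal.continuousAt_add (p := (_, _)) (.inl ?_) (.inl ?_)).tendsto.comp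
    (tendsto_const_nhds.prodMk_nhds hlim')
  · exact fun h => hp (EReal.coe_ennreal_eq_top_iff.1 h)
  · exact EReal.coe_ennreal_ne_bot _

end TruncLog

namespace IsSubmultiplicativeCocycle

variable {Ω : Type*} {T : Ω → Ω} {N : ℕ → Ω → ℝ}

/-- The floor `exp (-M n)` is multiplicative in `n`, and the maximum of two nonnegative
submultiplicative cocycles is again submultiplicative. A floor independent of `n` would not work. -/
theorem isSubadditiveCocycle_truncLog (hN : IsSubmultiplicativeCocycle T N) (M : ℕ) :
    IsSubadditiveCocycle T (truncLog N M) := by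
  refine ⟨fun ω => ?_, fun m n ω => ?_⟩
  · rw [truncLog_of_le] <;> simp [hN.zero_le ω]
  · rw [truncLog, truncLog, truncLog, ← Real.log_mul (truncLog_pos_arg M m ω).ne'
      (truncLog_pos_arg M n _).ne']
    refine Real.log_le_log (truncLog_pos_arg M (m + n) ω) (max_le ?_ ?_)
    · exact (hN.mul_le m n ω).trans (mul_le_mul (le_max_left _ _) (le_max_left _ _)
        (hN.nonneg _ _) (truncLog_pos_arg M m ω).le)
    · calc Real.exp (-((M : ℝ) * ((m + n : ℕ) : ℝ)))
          = Real.exp (-((M : ℝ) * m)) * Real.exp (-((M : ℝ) * n)) := by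
            rw [← Real.exp_add]; push_cast; ring_nf
        _ ≤ _ := mul_le_mul (le_max_right _ _) (le_max_right _ _) (Real.exp_pos _).le
            (truncLog_pos_arg M m ω).le

variable [MeasurableSpace Ω] {P : Measure Ω} [IsProbabilityMeasure P]

/-- Sandwich between `-M n` and the Birkhoff sum of `log⁺ (N 1)`: one-step integrability controls
all times. -/
theorem integrable_truncLog (hT : MeasurePreserving T P P) (hN : IsSubmultiplicativeCocycle T N)
    (hmeas : ∀ n, AEMeasurable (N n) P) (hint : Integrable (fun ω => Real.posLog (N 1 ω)) P)
    (M n : ℕ) : Integrable (truncLog N M n) P := by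
  have h0 : Integrable (fun ω => max (truncLog N 0 1 ω) 0) P := by
    refine Integrable.pos_part ?_
    refine hint.congr (.of_forall fun ω => (truncLog_zero_eq_posLog (hN.nonneg 1 ω)).symm)
  have hb := (integrable_birkhoffSum hT h0 n).add (integrable_const ((M : ℝ) * n))
  refine hb.mono' ?_ (.of_forall fun ω => ?_)
  · exact (Real.measurable_log.comp_aemeasurable
      ((hmeas n).max aemeasurable_const)).aestronglyMeasurable
  · have h1 := (hN.isSubadditiveCocycle_truncLog 0).le_birkhoffSum n ω
    have h2 := truncLog_anti (N := N) n ω (Nat.zero_le M)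
    have h3 := neg_mul_le_truncLog (N := N) M n ω
    have h4 : 0 ≤ birkhoffSum T (fun ω => max (truncLog N 0 1 ω) 0) n ω :=
      Finset.sum_nonneg fun _ _ => le_max_right _ _
    have h5 : 0 ≤ (M : ℝ) * n := by positivity
    simp only at h2
    rw [Real.norm_eq_abs, abs_le, Pi.add_apply]
    constructor <;> linarith

/-- **Existence of the Lyapunov exponent** of a submultiplicative cocycle over a map all of whose
powers are ergodic. -/
theorem exists_isLyapunovExponent (hT : ∀ m, 1 ≤ m → Ergodic T^[m] P)
    (hN : IsSubmultiplicativeCocycle T N) (hmeas : ∀ n, AEMeasurable (N n) P)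
    (hint : Integrable (fun ω => Real.posLog (N 1 ω)) P) :
    ∃ l : EReal, IsLyapunovExponent P N l := by
  have hmp : MeasurePreserving T P P := (by simpa using hT 1 le_rfl : Ergodic T P).1
  have hi := hN.integrable_truncLog hmp hmeas hint
  have hsub : ∀ M, Subadditive fun n => ∫ ω, truncLog N M n ω ∂P := fun M m n => by
    have hc : Integrable (fun ω => truncLog N M n (T^[m] ω)) P :=
      (hmp.iterate m).integrable_comp_of_integrable (hi M n)
    have := integral_mono (hi M (m + n)) ((hi M m).add hc)
      ((hN.isSubadditiveCocycle_truncLog M).add_le m n)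
    rwa [integral_add' (hi M m) hc, integral_comp_iterate hmp (hi M n)] at this
  have hbdd : ∀ M, BddBelow (Set.range fun n : ℕ => (∫ ω, truncLog N M n ω ∂P) / n) := by
    refine fun M => ⟨-(M : ℝ), ?_⟩
    rintro _ ⟨n, rfl⟩
    rcases Nat.eq_zero_or_pos n with rfl | hn
    · simp
    · have := integral_mono (integrable_const _) (hi M n) (neg_mul_le_truncLog M n)
      simp only [integral_const, probReal_univ, one_smul] at this
      simp only
      rw [le_div_iff₀ (by exact_mod_cast hn)]
      linarith
  have hlam := fun M => (hsub M).tendsto_lim (hbdd M)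
  have hlam_le : ∀ M {n : ℕ}, 1 ≤ n → (hsub M).lim ≤ (∫ ω, truncLog N M n ω ∂P) / n :=
    fun M n hn => (hsub M).lim_le_div (hbdd M) (by omega)
  set lam := fun M => (hsub M).lim
  have hEle : ∀ M {n : ℕ}, 1 ≤ n → extExpectation P (fun ω => extLog (N n ω)) ≤
      ((∫ ω, truncLog N M n ω ∂P : ℝ) : EReal) := by
    intro M n hn
    refine Antitone.le_of_tendsto (fun M M' h => ?_)
      (tendsto_integral_truncLog hn (hN.nonneg n) (fun M => hi M n)) M
    exact EReal.coe_le_coe_iff.2 (integral_mono (hi M' n) (hi M n)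
      fun ω => truncLog_anti n ω h)
  have hdiv : ∀ (x : ℝ) (n : ℕ), ((x / n : ℝ) : EReal) = (x : EReal) / (n : EReal) := by
    intro x n
    rw [EReal.coe_div, EReal.coe_natCast]
  have hn0 : ∀ n : ℕ, (0 : EReal) ≤ n := fun n => Nat.cast_nonneg' n
  have hnpos : ∀ {n : ℕ}, 1 ≤ n → (0 : EReal) < n := fun hn => by exact_mod_cast hn
  have hntop : ∀ n : ℕ, (n : EReal) ≠ ⊤ := fun n => EReal.natCast_ne_top n
  have hEdiv : ∀ M {n : ℕ}, 1 ≤ n → extExpectation P (fun ω => extLog (N n ω)) / (n : EReal) ≤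
      (((∫ ω, truncLog N M n ω ∂P) / n : ℝ) : EReal) := by
    intro M n hn
    rw [hdiv]
    exact EReal.div_le_div_right_of_nonneg (hn0 n) (hEle M hn)
  set l : EReal := ⨅ (n : ℕ) (_ : 1 ≤ n),
    extExpectation P (fun ω => extLog (N n ω)) / (n : EReal) with hl
  have hl_le : ∀ {n : ℕ}, 1 ≤ n →
      l ≤ extExpectation P (fun ω => extLog (N n ω)) / (n : EReal) := fun hn => iInf₂_le _ hn
  have hl_lam : ∀ M, l ≤ (lam M : EReal) := by
    intro M
    refine ge_of_tendsto (continuous_coe_real_ereal.continuousAt.tendsto.comp (hlam M)) ?_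
    filter_upwards [eventually_ge_atTop 1] with n hn using (hl_le hn).trans (hEdiv M hn)
  -- With `hl_lam`, this says that `l` is the infimum of the truncated exponents: choose `n` nearly
  -- optimal for `l`, then `M` large for that `n`.
  have hlam_lt : ∀ c, l < c → ∃ M, (lam M : EReal) < c := by
    intro c hc
    rw [hl] at hc
    simp only [iInf_lt_iff] at hc
    obtain ⟨n, hn, hlt⟩ := hc
    rw [EReal.div_lt_iff (hnpos hn) (hntop n)] at hlt
    obtain ⟨M, hM⟩ := ((tendsto_integral_truncLog hn (hN.nonneg n)
      (fun M => hi M n)).eventually (gt_mem_nhds hlt)).exists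
    refine ⟨M, lt_of_le_of_lt (EReal.coe_le_coe_iff.2 (hlam_le M hn)) ?_⟩
    rw [hdiv, EReal.div_lt_iff (hnpos hn) (hntop n)]
    exact hM
  have hae : ∀ᵐ ω ∂P, ∀ M, Tendsto (fun n : ℕ => truncLog N M n ω / n) atTop (𝓝 (lam M)) :=
    ae_all_iff.2 fun M => (hN.isSubadditiveCocycle_truncLog M).ae_tendsto_div hT (hi M)
      (fun n hn => hlam_le M hn) (hlam M)
  refine ⟨l, (hl_lam 0).trans_lt (EReal.coe_lt_top _), ?_, rfl, ?_⟩
  · filter_upwards [hae] with ω hω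
    refine tendsto_order.2 ⟨fun a ha => ?_, fun a ha => ?_⟩
    · obtain ⟨l', hl'⟩ : ∃ l' : ℝ, l = l' := by
        refine ⟨l.toReal, (EReal.coe_toReal ?_ (bot_le.trans_lt ha).ne').symm⟩
        exact ((hl_lam 0).trans_lt (EReal.coe_lt_top _)).ne
      -- Since `lam M ≥ l' > -M`, the truncated logarithm eventually lies strictly above its floor,
      -- so the truncation is inactive and the true logarithm has the same limit. If `l = ⊥` there
      -- is no lower bound to prove.
      obtain ⟨M, hM⟩ := exists_nat_gt (-l')
      have hlM : l' ≤ lam M := by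
        have := hl_lam M
        rwa [hl', EReal.coe_le_coe_iff] at this
      have hE := ((continuous_coe_real_ereal.continuousAt.tendsto.comp (hω M)).eventually
        (lt_mem_nhds (ha.trans_le (hl_lam M))))
      filter_upwards [hE, (hω M).eventually (lt_mem_nhds (show -(M : ℝ) < lam M by linarith)),
        eventually_ge_atTop 1] with n h1 h2 hn
      have hnr : (0 : ℝ) < n := by exact_mod_cast hn
      have hgt : Real.exp (-((M : ℝ) * n)) < N n ω := by
        by_contra hle
        rw [truncLog_of_le (not_lt.1 hle), lt_div_iff₀ hnr] at h2
        linarith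
      simp only [Function.comp] at h1
      rwa [truncLog_of_ge hgt.le, hdiv, ← extLog_of_pos ((Real.exp_pos _).trans hgt)] at h1
    · obtain ⟨M, hM⟩ := hlam_lt a ha
      have hE := ((continuous_coe_real_ereal.continuousAt.tendsto.comp (hω M)).eventually
        (gt_mem_nhds hM))
      filter_upwards [hE] with n h1
      refine lt_of_le_of_lt ?_ h1
      simp only [Function.comp, hdiv]
      exact EReal.div_le_div_right_of_nonneg (hn0 n) (extLog_le_truncLog M n ω)
  · refine tendsto_order.2 ⟨fun a ha => ?_, fun a ha => ?_⟩
    · filter_upwards [eventually_ge_atTop 1] with n hn using ha.trans_le (hl_le hn)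
    · obtain ⟨M, hM⟩ := hlam_lt a ha
      filter_upwards [(continuous_coe_real_ereal.continuousAt.tendsto.comp (hlam M)).eventually
        (gt_mem_nhds hM), eventually_ge_atTop 1] with n h1 hn
      exact (hEdiv M hn).trans_lt h1

end IsSubmultiplicativeCocycle

/-- A sequence dominated by a multiple of the square of another one grows exponentially at most at
twice its rate. -/
theorem limsup_extLog_div_le_two_mul {u v : ℕ → ℝ} {C : ℝ} (hv : ∀ n, 0 ≤ v n)
    (huv : ∀ n, u n ≤ C * v n ^ 2) {l : EReal}
    (h : Tendsto (fun n : ℕ => extLog (v n) / (n : EReal)) atTop (𝓝 l)) :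
    limsup (fun n : ℕ => extLog (u n) / (n : EReal)) atTop ≤ 2 * l := by
  -- `C` may be zero or negative; replacing it by `D ≥ 1` makes its logarithm a real number, which
  -- disappears after division by `n`.
  set D := max C 1 with hD
  have hD0 : 0 < D := lt_max_of_lt_right one_pos
  have hle : ∀ n : ℕ, extLog (u n) / (n : EReal) ≤
      ((Real.log D / n : ℝ) : EReal) + 2 * (extLog (v n) / (n : EReal)) := by
    intro n
    have h1 : extLog (u n) ≤ (Real.log D : EReal) + 2 * extLog (v n) := by
      rw [← extLog_of_pos hD0, extLog, extLog, extLog, ← Nat.cast_two, ← ENNReal.log_pow,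
        ← ENNReal.log_mul_add, ← ENNReal.ofReal_pow (hv n), ← ENNReal.ofReal_mul hD0.le]
      refine ENNReal.log_monotone (ENNReal.ofReal_le_ofReal ((huv n).trans ?_))
      gcongr
      exact le_max_left _ _
    have hn : (0 : EReal) ≤ n := Nat.cast_nonneg' n
    refine (EReal.div_le_div_right_of_nonneg hn h1).trans_eq ?_
    rw [EReal.add_div_of_nonneg_right hn, EReal.mul_div, EReal.coe_div, EReal.coe_natCast]
  have hlim : Tendsto (fun n : ℕ => ((Real.log D / n : ℝ) : EReal) +
      2 * (extLog (v n) / (n : EReal))) atTop (𝓝 (((0 : ℝ) : EReal) + 2 * l)) := by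
    refine (EReal.continuousAt_add (p := (_, _)) (.inl (EReal.coe_ne_top _))
      (.inl (EReal.coe_ne_bot _))).tendsto.comp (Tendsto.prodMk_nhds ?_ ?_)
    · exact continuous_coe_real_ereal.continuousAt.tendsto.comp
        (tendsto_const_div_atTop_nhds_zero_nat _)
    · exact EReal.Tendsto.const_mul h (.inl (by decide)) (.inl (by decide))
  rw [EReal.coe_zero, zero_add] at hlim
  rw [← hlim.limsup_eq]
  exact limsup_le_limsup (.of_forall hle)

/-! ### The word operators and the iterated kernels -/

section Words

variable {X H S : Type*} {I : S → Type*} [NormedAddCommGroup H] [InnerProductSpace ℂ H]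

open Classical in
theorem inner_elementary (K : PDKernel X H) (ρ ρ' : KrausString I)
    (F G : KernelSpace K) :
    ⟪elementary K ρ F, elementary K ρ' G⟫_ℂ = if ρ = ρ' then ⟪F, G⟫_ℂ else 0 := by
  rw [elementary, elementary, lp.inner_single_left]
  split_ifs with h
  · subst h
    rw [lp.single_apply_self]
  · rw [lp.single_apply_ne _ _ _ h, inner_zero_right]

theorem norm_elementary (K : PDKernel X H) (ρ : KrausString I) (F : KernelSpace K) :
    ‖elementary K ρ F‖ = ‖F‖ := by
  rw [norm_eq_sqrt_re_inner (𝕜 := ℂ), inner_elementary, if_pos rfl, ← norm_eq_sqrt_re_inner]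

open Classical in
/-- The word operators realise the iterated kernels as Gram kernels. -/
theorem inner_wordOperator_elementary [CompleteSpace H]
    {K : PDKernel X H} {Φ : S → (H →L[ℂ] H) →ₗ[ℂ] (H →L[ℂ] H)} {A : ∀ s, I s → H →L[ℂ] H}
    (hΦ : ∀ s, HasKrausFamily (Φ s) (A s)) {C : S → ModelSpace K I →L[ℂ] ModelSpace K I}
    (hC : ∀ s, IsCreationOperator K A s (C s)) (w : List S) (ρ ρ' : KrausString I) (x y : X)
    (a b : H) :
    ⟪wordOperator C w (elementary K ρ (kernelSection K x a)),
      wordOperator C w (elementary K ρ' (kernelSection K y b))⟫_ℂ =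
      if ρ = ρ' then ⟪a, iteratedKernel Φ K w x y b⟫_ℂ else 0 := by
  induction w generalizing ρ ρ' a b with
  | nil =>
    simp only [wordOperator, iteratedKernel, ContinuousLinearMap.id_apply, inner_elementary,
      inner_kernelSection]
  | cons s w ih =>
    set W := wordOperator C w with hW
    simp only [wordOperator, iteratedKernel, ContinuousLinearMap.comp_apply, ← hW]
    have h1 := (hC s ρ x a).mapL W
    have h2 := (hC s ρ' y b).mapL W
    -- The sum is expanded one variable at a time. For fixed `r` the induction hypothesis leaves
    -- only the term `q = r`, since prefixed strings agree only when both heads and tails do.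
    have h3 : ∀ r : I s, ⟪W (elementary K (⟨s, r⟩ :: ρ) (kernelSection K x (A s r a))),
        W (C s (elementary K ρ' (kernelSection K y b)))⟫_ℂ =
        if ρ = ρ' then ⟪A s r a, iteratedKernel Φ K w x y (A s r b)⟫_ℂ else 0 := by
      intro r
      refine (h2.mapL (innerSL ℂ (W (elementary K (⟨s, r⟩ :: ρ)
        (kernelSection K x (A s r a)))))).unique ?_
      simp only [innerSL_apply_apply, ih]
      have e : (fun q : I s => if (⟨s, r⟩ :: ρ : KrausString I) = ⟨s, q⟩ :: ρ' then
          ⟪A s r a, iteratedKernel Φ K w x y (A s q b)⟫_ℂ else 0) =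
          fun q => if q = r then (if ρ = ρ' then
            ⟪A s r a, iteratedKernel Φ K w x y (A s r b)⟫_ℂ else 0) else 0 := by
        funext q
        by_cases hq : q = r
        · subst hq; simp
        · simp [hq, Ne.symm hq]
      rw [e]
      exact hasSum_ite_eq r _
    have h4 := (innerSLFlip ℂ (W (C s (elementary K ρ' (kernelSection K y b))))).hasSum h1
    simp only [innerSLFlip_apply_apply, h3] at h4
    refine h4.unique ?_
    split_ifs with h
    -- The remaining sum over `r` is the Kraus expansion of `Φ s`, paired with `a`; strong
    -- convergence is enough for this.
    · have h5 := (hΦ s (iteratedKernel Φ K w x y) b).mapL (innerSL ℂ a)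
      simpa only [innerSL_apply_apply, ContinuousLinearMap.adjoint_inner_right] using h5
    · exact hasSum_zero

theorem norm_kernelSection_le (K : PDKernel X H) (x : X) (a : H) :
    ‖kernelSection K x a‖ ≤ √‖K.toFun x x‖ * ‖a‖ := by
  refine le_of_sq_le_sq ?_ (by positivity)
  rw [mul_pow, Real.sq_sqrt (norm_nonneg _), ← inner_self_eq_norm_sq (𝕜 := ℂ),
    inner_kernelSection]
  refine (RCLike.re_le_norm _).trans ((norm_inner_le_norm _ _).trans ?_)
  have := (K.toFun x x).le_opNorm a
  nlinarith [norm_nonneg a]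

/-- Cauchy–Schwarz in the Gram identity, with both vectors in the summand of the empty string. -/
theorem norm_inner_iteratedKernel_le [CompleteSpace H]
    {K : PDKernel X H} {Φ : S → (H →L[ℂ] H) →ₗ[ℂ] (H →L[ℂ] H)} {A : ∀ s, I s → H →L[ℂ] H}
    (hΦ : ∀ s, HasKrausFamily (Φ s) (A s)) {C : S → ModelSpace K I →L[ℂ] ModelSpace K I}
    (hC : ∀ s, IsCreationOperator K A s (C s)) (w : List S) (x y : X) (a b : H) :
    ‖⟪a, iteratedKernel Φ K w x y b⟫_ℂ‖ ≤
      √‖K.toFun x x‖ * √‖K.toFun y y‖ * ‖wordOperator C w‖ ^ 2 * ‖a‖ * ‖b‖ := by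
  classical
  have h := inner_wordOperator_elementary hΦ hC w [] [] x y a b
  rw [if_pos rfl] at h
  rw [← h]
  have hb : ∀ (x : X) (a : H), ‖wordOperator C w (elementary K [] (kernelSection K x a))‖ ≤
      ‖wordOperator C w‖ * (√‖K.toFun x x‖ * ‖a‖) := fun x a =>
    ((wordOperator C w).le_opNorm _).trans (by
      rw [norm_elementary]
      gcongr
      exact norm_kernelSection_le K x a)
  calc _ ≤ _ := norm_inner_le_norm _ _
    _ ≤ _ := mul_le_mul (hb x a) (hb y b) (norm_nonneg _) (by positivity)
    _ = _ := by ring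

theorem norm_iteratedKernel_le [CompleteSpace H]
    {K : PDKernel X H} {Φ : S → (H →L[ℂ] H) →ₗ[ℂ] (H →L[ℂ] H)} {A : ∀ s, I s → H →L[ℂ] H}
    (hΦ : ∀ s, HasKrausFamily (Φ s) (A s)) {C : S → ModelSpace K I →L[ℂ] ModelSpace K I}
    (hC : ∀ s, IsCreationOperator K A s (C s)) (w : List S) (x y : X) :
    ‖iteratedKernel Φ K w x y‖ ≤
      √‖K.toFun x x‖ * √‖K.toFun y y‖ * ‖wordOperator C w‖ ^ 2 :=
  ContinuousLinearMap.opNorm_le_of_re_inner_le (𝕜 := ℂ) (by positivity) fun b a hb ha => by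
    rw [inner_re_symm]
    refine (RCLike.re_le_norm _).trans
      ((norm_inner_iteratedKernel_le hΦ hC w x y a b).trans_eq ?_)
    rw [ha, hb, mul_one, mul_one]

theorem wordOperator_append {M : Type*} [NormedAddCommGroup M] [NormedSpace ℂ M]
    (C : S → M →L[ℂ] M) (w w' : List S) :
    wordOperator C (w ++ w') = (wordOperator C w').comp (wordOperator C w) := by
  induction w with
  | nil => rfl
  | cons s w ih => simp only [List.cons_append, wordOperator, ih]; rfl

theorem randomWord_add (ω : ℕ → S) (m n : ℕ) :
    randomWord ω (m + n) = randomWord ω m ++ randomWord (pathShift^[m] ω) n := by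
  simp only [randomWord, List.range_add, List.map_append, List.map_map, iterate_pathShift]
  congr 1
  refine List.map_congr_left fun i _ => ?_
  simp [add_comm]

theorem isSubmultiplicativeCocycle_norm_wordOperator {M : Type*} [NormedAddCommGroup M]
    [NormedSpace ℂ M] (C : S → M →L[ℂ] M) :
    IsSubmultiplicativeCocycle pathShift fun n ω => ‖wordOperator C (randomWord ω n)‖ where
  nonneg _ _ := norm_nonneg _
  zero_le _ := ContinuousLinearMap.norm_id_le
  mul_le m n ω := by
    -- The operator of the later block acts last and so stands on the left; the norm factors are
    -- swapped to match.
    rw [randomWord_add, wordOperator_append, mul_comm]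
    exact ContinuousLinearMap.opNorm_comp_le _ _

end Words

theorem corollary5p2 {X H S : Type*} {I : S → Type*}
    [NormedAddCommGroup H] [InnerProductSpace ℂ H] [CompleteSpace H] [MeasurableSpace S]
    (K : PDKernel X H)
    (Φ : S → (H →L[ℂ] H) →ₗ[ℂ] (H →L[ℂ] H)) (A : ∀ s, I s → H →L[ℂ] H)
    (hΦ : ∀ s, HasKrausFamily (Φ s) (A s))
    -- each `C_s` is a bounded operator on the model space
    (hC : ∀ s, HasCreationOperator K A s)
    (μ : Measure S) [IsProbabilityMeasure μ]
    -- the random variables `‖C_{ξ_n}‖` are measurable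
    (hmeas : ∀ n : ℕ, AEMeasurable
      (fun ω => ‖wordOperator (fun s => creationOperator (hC s)) (randomWord ω n)‖)
      (pathMeasure μ))
    -- `E[log⁺ ‖C_{z₁}‖] < ∞`
    (hint : Integrable (fun ω : ℕ → S => Real.posLog ‖creationOperator (hC (ω 0))‖)
      (pathMeasure μ)) :
    ∃ l : EReal,
      IsLyapunovExponent (pathMeasure μ)
        (fun n ω => ‖wordOperator (fun s => creationOperator (hC s)) (randomWord ω n)‖) l ∧
      (∀ (x y : X) (a b : H), ∀ᵐ ω ∂(pathMeasure μ),
        limsup (fun n : ℕ =>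
          extLog ‖⟪a, iteratedKernel Φ K (randomWord ω n) x y b⟫_ℂ‖ / (n : EReal)) atTop
          ≤ 2 * l) ∧
      (∀ x y : X, ∀ᵐ ω ∂(pathMeasure μ),
        limsup (fun n : ℕ =>
          extLog ‖iteratedKernel Φ K (randomWord ω n) x y‖ / (n : EReal)) atTop
          ≤ 2 * l) := by
  have hspec := fun s => creationOperator_spec (hC s)
  set C := fun s => creationOperator (hC s)
  obtain ⟨l, hl⟩ := (isSubmultiplicativeCocycle_norm_wordOperator C).exists_isLyapunovExponent
    (P := pathMeasure μ) (fun m hm => ergodic_iterate_pathShift μ hm) hmeas (by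
      refine hint.congr (.of_forall fun ω => ?_)
      simp only [randomWord, List.range_one, List.map_cons, List.map_nil, wordOperator,
        ContinuousLinearMap.id_comp]
      rfl)
  refine ⟨l, hl, fun x y a b => ?_, fun x y => ?_⟩
  · filter_upwards [hl.tendsto_ae] with ω hω
    refine limsup_extLog_div_le_two_mul (C := √‖K.toFun x x‖ * √‖K.toFun y y‖ * ‖a‖ * ‖b‖)
      (fun n => norm_nonneg _) (fun n => ?_) hω
    refine (norm_inner_iteratedKernel_le hΦ hspec (randomWord ω n) x y a b).trans_eq ?_
    ring
  · filter_upwards [hl.tendsto_ae] with ω hω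
    exact limsup_extLog_div_le_two_mul (fun n => norm_nonneg _)
      (fun n => norm_iteratedKernel_le hΦ hspec (randomWord ω n) x y) hω
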